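/- Let $\mathbb{C}^2=\mathbb{R}^4$ carry its standard metric $\langle\cdot,\cdot\rangle$, complex structure $J$ and symplectic form $\omega=\sum_k dx_k\wedge dy_k$, so that $\langle V,W\rangle=\omega(V,JW)$. Let $f:\Sigma\to\mathbb{C}^2$ be a smooth (for instance, properly) immersed Lagrangian surface, i.e. $\Sigma$ is a smooth surface and $f$ is a smooth immersion with $f^*\omega=0$. Let $g$ be the induced metric, $A=(D^2f)^\perp$ the second fundamental form, $H=\operatorname{tr}_g A$, $\mathring{A}=A-\tfrac12\, g\otimes H$, and $$\check A(v,w)=A(v,w)-\tfrac14\big\{\langle v,w\rangle H+\langle Jv,H\rangle Jw+\langle Jw,H\rangle Jv\big\}.$$ For a normal-bundle-valued $(0,2)$-tensor $B$ and a normal field $\phi$ put $Q(B)\phi=\sum_{i,j}B(e_i,e_j)\langle B(e_i,e_j),\phi\rangle$, where $\{e_1,e_2\}$ is an orthonormal basis of the tangent plane. Let $\nabla$ denote the induced covariant derivatives on the tangent and normal bundles, $\nabla^*S=-\sum_i e_i\lrcorner\nabla_{e_i}S$, and $\Delta=-\nabla^*\nabla$. Let $\phi\lrcorner\omega$ be the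 $1$-form $v\mapsto\omega(\phi,v)$ on $\Sigma$, and let $T=\nabla(H\lrcorner\omega)-\tfrac12\operatorname{div}(JH)\,g$. Then the Willmore operator $W=\Delta H+Q(\mathring A)H$ satisfies $$W=\Delta H+\tfrac18|H|^2H+Q(\check A)H+\check A(JH,JH),$$ and, in the dual form, $$W\lrcorner\omega=-2\nabla^*T+\tfrac12|\check A|^2\,H\lrcorner\omega+\big(Q(\check A)H\big)\lrcorner\omega+\check A(JH,JH)\lrcorner\omega .$$ -/

import Mathlib

open scoped Manifold ContDiff

noncomputable section

namespace LagrangianSurface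

/-! ### The ambient space `ℂ²` -/

/-- The parameter plane `ℝ²` on which surfaces are modelled. -/
abbrev Plane : Type := EuclideanSpace ℝ (Fin 2)

/-- The ambient space `ℂ² = ℝ⁴`; its real inner product `inner ℝ v w = ∑ Re (conj vₖ * wₖ)` is the
standard Euclidean metric. -/
abbrev C2 : Type := EuclideanSpace ℂ (Fin 2)

/-- The standard complex structure of `ℂ²`. -/
def J (v : C2) : C2 := Complex.I • v

/-- The standard symplectic form `ω = ∑ dxₖ ∧ dyₖ` of `ℂ²`, where `zₖ = xₖ + i yₖ`;
it satisfies `⟨v, w⟩ = ω(v, J w)`. -/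
def omega (v w : C2) : ℝ := ∑ k, ((v k).re * (w k).im - (v k).im * (w k).re)

/-! ### Lagrangian immersions of surfaces -/

/-- A smooth immersion `f : M → ℂ²` of a surface with `f^* ω = 0`. -/
structure IsLagrangianImmersion {M : Type*} [TopologicalSpace M] [ChartedSpace Plane M]
    (f : M → C2) : Prop where
  smooth : ContMDiff 𝓘(ℝ, Plane) 𝓘(ℝ, C2) ∞ f
  injective_mfderiv : ∀ p : M, Function.Injective (mfderiv 𝓘(ℝ, Plane) 𝓘(ℝ, C2) f p)
  lagrangian : ∀ (p : M) (v w : TangentSpace 𝓘(ℝ, Plane) p),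
    omega (mfderiv 𝓘(ℝ, Plane) 𝓘(ℝ, C2) f p v) (mfderiv 𝓘(ℝ, Plane) 𝓘(ℝ, C2) f p w) = 0

/-! ### Geometry of a surface in local coordinates

Below `u : ℝ² → ℂ²` is an immersion on a neighbourhood of `x` (a surface written in a coordinate
chart). Tensors on the surface are given by their components with respect to the coordinate fields
`∂₀, ∂₁`; a tensor with values in the normal bundle has components in `ℂ²`. -/

/-- The partial derivative `∂ᵢ φ` of a (vector valued) function on the parameter plane. -/
def pd {V : Type*} [NormedAddCommGroup V] [NormedSpace ℝ V] (i : Fin 2) (φ : Plane → V)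
    (x : Plane) : V :=
  fderiv ℝ φ x (EuclideanSpace.single i 1)

/-- The induced metric `g_{ij} = ⟨∂ᵢ u, ∂ⱼ u⟩`. -/
def metric (u : Plane → C2) (x : Plane) : Matrix (Fin 2) (Fin 2) ℝ :=
  Matrix.of fun i j => inner ℝ (pd i u x) (pd j u x)

/-- The inverse metric `g^{ij}`. -/
def metricInv (u : Plane → C2) (x : Plane) : Matrix (Fin 2) (Fin 2) ℝ := (metric u x)⁻¹

/-- The Christoffel symbols `Γᵏ_{ij}` of the Levi-Civita connection of the induced metric. -/
def christoffel (u : Plane → C2) (k i j : Fin 2) (x : Plane) : ℝ :=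
  (1 / 2) * ∑ l, metricInv u x k l *
    (pd i (fun y => metric u y j l) x + pd j (fun y => metric u y i l) x
      - pd l (fun y => metric u y i j) x)

/-- The components `Vⁱ` of the tangential part of an ambient vector `V`, that is,
`V^⊤ = ∑ Vⁱ ∂ᵢ u`. -/
def tangComp (u : Plane → C2) (x : Plane) (V : C2) (i : Fin 2) : ℝ :=
  ∑ k, metricInv u x i k * inner ℝ V (pd k u x)

/-- The normal part `V^⊥` of an ambient vector `V`. -/
def normalPart (u : Plane → C2) (x : Plane) (V : C2) : C2 :=
  V - ∑ i, tangComp u x V i • pd i u x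

/-- The second fundamental form `A_{ij} = (∂ᵢ ∂ⱼ u)^⊥`. -/
def secondFF (u : Plane → C2) (i j : Fin 2) (x : Plane) : C2 :=
  normalPart u x (pd i (pd j u) x)

/-- The mean curvature vector `H = tr A`. -/
def meanCurv (u : Plane → C2) (x : Plane) : C2 :=
  ∑ i, ∑ j, metricInv u x i j • secondFF u i j x

/-- The trace-free second fundamental form `Å = A - ½ g ⊗ H`. -/
def tracefreeA (u : Plane → C2) (i j : Fin 2) (x : Plane) : C2 :=
  secondFF u i j x - ((1 / 2 : ℝ) * metric u x i j) • meanCurv u x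

/-- The Lagrangian trace-free second fundamental form
`Ǎ(v, w) = A(v, w) - ¼ (⟨v, w⟩ H + ⟨J v, H⟩ J w + ⟨J w, H⟩ J v)`. -/
def checkA (u : Plane → C2) (i j : Fin 2) (x : Plane) : C2 :=
  secondFF u i j x - (1 / 4 : ℝ) •
    (metric u x i j • meanCurv u x
      + (inner ℝ (J (pd i u x)) (meanCurv u x) : ℝ) • J (pd j u x)
      + (inner ℝ (J (pd j u x)) (meanCurv u x) : ℝ) • J (pd i u x))

/-- `Q(B) φ = ∑ B(eₐ, e_b) ⟨B(eₐ, e_b), φ⟩` over an orthonormal basis `e₀, e₁` of the tangent plane,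
written as a contraction with the metric. Here `B` is a `ℂ²`-valued two-tensor. -/
def Qop (u : Plane → C2) (B : Fin 2 → Fin 2 → Plane → C2) (φ : Plane → C2) (x : Plane) : C2 :=
  ∑ i, ∑ j, ∑ k, ∑ l,
    (metricInv u x i k * metricInv u x j l * inner ℝ (B k l x) (φ x)) • B i j x

/-- The squared norm `|B|²` of a `ℂ²`-valued two-tensor. -/
def normSqTensor (u : Plane → C2) (B : Fin 2 → Fin 2 → Plane → C2) (x : Plane) : ℝ :=
  ∑ i, ∑ j, ∑ k, ∑ l, metricInv u x i k * metricInv u x j l * inner ℝ (B i j x) (B k l x)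

/-- The value `B(V, V)` of a `ℂ²`-valued two-tensor on a tangent vector `V ∈ ℂ²` of the surface. -/
def evalDiag (u : Plane → C2) (B : Fin 2 → Fin 2 → Plane → C2) (V : Plane → C2) (x : Plane) : C2 :=
  ∑ i, ∑ j, (tangComp u x (V x) i * tangComp u x (V x) j) • B i j x

/-- The covariant derivative `(∇φ)ⱼ = (∂ⱼ φ)^⊥` of a normal field. -/
def normalDeriv (u : Plane → C2) (φ : Plane → C2) (j : Fin 2) (x : Plane) : C2 :=
  normalPart u x (pd j φ x)

/-- The covariant derivative `(∇θ)_{ij} = (∂ᵢ θⱼ)^⊥ - Γᵏ_{ij} θₖ` of a one-form with values in the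
normal bundle; `i` is the direction of differentiation. -/
def normalDerivForm (u : Plane → C2) (θ : Fin 2 → Plane → C2) (i j : Fin 2) (x : Plane) : C2 :=
  normalPart u x (pd i (θ j) x) - ∑ k, christoffel u k i j x • θ k x

/-- The rough Laplacian `Δφ = -∇^* ∇φ = g^{ij} (∇²φ)_{ij}` on the normal bundle. -/
def normalLaplacian (u : Plane → C2) (φ : Plane → C2) (x : Plane) : C2 :=
  ∑ i, ∑ j, metricInv u x i j • normalDerivForm u (normalDeriv u φ) i j x

/-- The Willmore operator `W = ΔH + Q(Å) H`. -/
def willmoreOp (u : Plane → C2) (x : Plane) : C2 :=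
  normalLaplacian u (meanCurv u) x + Qop u (tracefreeA u) (meanCurv u) x

/-- The one-form `V ⌟ ω` on the surface, for a `ℂ²`-valued field `V`:
its components are `ω(V, ∂ᵢ u)`. -/
def contract (u : Plane → C2) (V : Plane → C2) (i : Fin 2) (x : Plane) : ℝ :=
  omega (V x) (pd i u x)

/-- The covariant derivative `(∇θ)_{ij} = ∂ᵢ θⱼ - Γᵏ_{ij} θₖ` of a one-form. -/
def covDerivForm (u : Plane → C2) (θ : Fin 2 → Plane → ℝ) (i j : Fin 2) (x : Plane) : ℝ :=
  pd i (θ j) x - ∑ k, christoffel u k i j x * θ k x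

/-- The covariant derivative `(∇S)_{ijk} = ∂ᵢ S_{jk} - Γˡ_{ij} S_{lk} - Γˡ_{ik} S_{jl}` of a
`(0,2)`-tensor. -/
def covDerivTensor (u : Plane → C2) (S : Fin 2 → Fin 2 → Plane → ℝ) (i j k : Fin 2)
    (x : Plane) : ℝ :=
  pd i (S j k) x - ∑ l, christoffel u l i j x * S l k x - ∑ l, christoffel u l i k x * S j l x

/-- The adjoint `∇^* S = -∑ eₐ ⌟ ∇_{eₐ} S` of the covariant derivative on `(0,2)`-tensors. -/
def adjointDeriv (u : Plane → C2) (S : Fin 2 → Fin 2 → Plane → ℝ) (k : Fin 2) (x : Plane) : ℝ :=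
  -∑ i, ∑ j, metricInv u x i j * covDerivTensor u S i j k x

/-- The divergence `div V = ∂ᵢ Vⁱ + Γⁱ_{ik} Vᵏ` of a tangent vector field `V`, given as a
`ℂ²`-valued function. -/
def divergence (u : Plane → C2) (V : Plane → C2) (x : Plane) : ℝ :=
  ∑ i, (pd i (fun y => tangComp u y (V y) i) x
    + ∑ k, christoffel u i i k x * tangComp u x (V x) k)

/-- The `(0,2)`-tensor `T = ∇(H ⌟ ω) - ½ div(JH) g`. -/
def tensorT (u : Plane → C2) (i j : Fin 2) (x : Plane) : ℝ :=
  covDerivForm u (contract u (meanCurv u)) i j x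
    - (1 / 2) * divergence u (fun y => J (meanCurv u y)) x * metric u x i j

end LagrangianSurface

end

/-! In a Lagrangian chart `J` is a parallel isometry exchanging tangent and normal planes, so normal
fields become one-forms and `A` becomes the cubic form `c_{ijk} = ⟨A_{ij}, J ∂ₖ⟩`. Differentiating
`f^*ω = 0` makes `c` totally symmetric (`inner_secondFF_J_symm`); its trace is `η_k = ⟨H, J ∂ₖ⟩`.

The first identity is then algebra: neither `Q(Å)H` nor the right-hand terms have a tangential part,
and pairing with `J ∂ₘ` leaves a polynomial identity in `c` and the inverse metric
(`cubic_form_identity`).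

For the dual form put `θ = H ⌟ ω` and `B = ∇θ`. Then `ΔH ⌟ ω = div B`, `B` is symmetric because `θ`
is closed, and `T = B - ½ (tr B) g`, so `-2∇^*T = 2 div B - d(tr B)`. Commuting derivatives gives
`div B - d(tr B) = Kθ`, where the Gauss equation yields `2K = |H|² - |A|²` (`contract_ricci`). Hence
`ΔH ⌟ ω = -2∇^*T + ½(|A|² - |H|²)θ`, and `|A|² = |Ǎ|² + ¾|H|²` (`cubic_form_norm`) turns the last
term into `½|Ǎ|²θ - ⅛|H|²θ`, whose second part cancels the `⅛|H|²H` of the first identity. -/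

namespace LagrangianSurface

open Filter Topology

/-! ### Partial derivatives -/

section PartialDerivatives

variable {V : Type*} [NormedAddCommGroup V] [NormedSpace ℝ V] {U : Set Plane} {x : Plane}

theorem pd_congr (hU : IsOpen U) (hx : x ∈ U) {φ ψ : Plane → V} (h : ∀ y ∈ U, φ y = ψ y)
    (i : Fin 2) : pd i φ x = pd i ψ x := by
  have : φ =ᶠ[𝓝 x] ψ := by
    filter_upwards [hU.mem_nhds hx] with y hy using h y hy
  simp only [pd, this.fderiv_eq]

theorem contDiffOn_pd (hU : IsOpen U) {φ : Plane → V} (h : ContDiffOn ℝ ∞ φ U) (i : Fin 2) :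
    ContDiffOn ℝ ∞ (pd i φ) U :=
  (h.fderiv_of_isOpen hU (by simp)).clm_apply contDiffOn_const

theorem differentiableAt_of_contDiffOn (hU : IsOpen U) (hx : x ∈ U) {φ : Plane → V}
    (h : ContDiffOn ℝ ∞ φ U) : DifferentiableAt ℝ φ x :=
  (h.contDiffAt (hU.mem_nhds hx)).differentiableAt (by simp)

theorem pd_const (c : V) (i : Fin 2) : pd i (fun _ => c) x = 0 := by
  simp [pd]

theorem pd_sub {φ ψ : Plane → V} (hφ : DifferentiableAt ℝ φ x) (hψ : DifferentiableAt ℝ ψ x)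
    (i : Fin 2) : pd i (fun y => φ y - ψ y) x = pd i φ x - pd i ψ x := by
  simp [pd, fderiv_fun_sub hφ hψ]

theorem pd_sum {ι : Type*} {s : Finset ι} {φ : ι → Plane → V}
    (hφ : ∀ a ∈ s, DifferentiableAt ℝ (φ a) x) (i : Fin 2) :
    pd i (fun y => ∑ a ∈ s, φ a y) x = ∑ a ∈ s, pd i (φ a) x := by
  simp [pd, fderiv_fun_sum hφ]

theorem pd_mul {φ ψ : Plane → ℝ} (hφ : DifferentiableAt ℝ φ x) (hψ : DifferentiableAt ℝ ψ x)
    (i : Fin 2) : pd i (fun y => φ y * ψ y) x = pd i φ x * ψ x + φ x * pd i ψ x := by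
  simp [pd, fderiv_fun_mul hφ hψ]; ring

theorem pd_smul {c : Plane → ℝ} {φ : Plane → V} (hc : DifferentiableAt ℝ c x)
    (hφ : DifferentiableAt ℝ φ x) (i : Fin 2) :
    pd i (fun y => c y • φ y) x = pd i c x • φ x + c x • pd i φ x := by
  simp [pd, fderiv_fun_smul hc hφ, add_comm]

theorem pd_inner {φ ψ : Plane → C2} (hφ : DifferentiableAt ℝ φ x) (hψ : DifferentiableAt ℝ ψ x)
    (i : Fin 2) : pd i (fun y => (inner ℝ (φ y) (ψ y) : ℝ)) x
      = inner ℝ (pd i φ x) (ψ x) + inner ℝ (φ x) (pd i ψ x) := by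
  simp only [pd, fderiv_inner_apply ℝ hφ hψ]; ring

theorem pd_comm (hU : IsOpen U) (hx : x ∈ U) {φ : Plane → V} (h : ContDiffOn ℝ ∞ φ U)
    (i j : Fin 2) : pd i (pd j φ) x = pd j (pd i φ) x := by
  have hc : ContDiffAt ℝ ∞ φ x := h.contDiffAt (hU.mem_nhds hx)
  have hd : DifferentiableAt ℝ (fderiv ℝ φ) x :=
    (hc.fderiv_right (m := 1) (by norm_cast)).differentiableAt (by simp)
  have key : ∀ i j : Fin 2, pd i (pd j φ) x
      = fderiv ℝ (fderiv ℝ φ) x (EuclideanSpace.single i 1) (EuclideanSpace.single j 1) := by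
    intro i j
    have : pd j φ = fun y => fderiv ℝ φ y (EuclideanSpace.single j 1) := rfl
    rw [this, LagrangianSurface.pd, fderiv_clm_apply hd (differentiableAt_const _)]
    simp
  rw [key, key]
  exact (hc.isSymmSndFDerivAt (by simp; norm_cast)).eq _ _

end PartialDerivatives

/-! ### Linear algebra of `ℂ²` -/

/-- The complex structure as a real continuous linear map. -/
noncomputable def Jclm : C2 →L[ℝ] C2 := (Complex.I • ContinuousLinearMap.id ℂ C2).restrictScalars ℝ

theorem J_add (v w : C2) : J (v + w) = J v + J w := smul_add _ _ _

theorem J_smul (c : ℝ) (v : C2) : J (c • v) = c • J v := Jclm.map_smul c v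

theorem J_sum {ι : Type*} (s : Finset ι) (v : ι → C2) : J (∑ a ∈ s, v a) = ∑ a ∈ s, J (v a) :=
  Finset.smul_sum

theorem J_J (v : C2) : J (J v) = -v := by
  simp [J, smul_smul]

theorem inner_J_left (v w : C2) : (inner ℝ (J v) w : ℝ) = -inner ℝ v (J w) := by
  simp [J, PiLp.inner_apply, Fin.sum_univ_two, Complex.inner]
  ring

theorem inner_J_J (v w : C2) : (inner ℝ (J v) (J w) : ℝ) = inner ℝ v w := by
  rw [inner_J_left, J_J, inner_neg_right, neg_neg]

theorem omega_eq_inner (v w : C2) : omega v w = inner ℝ (J v) w := by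
  simp [omega, J, PiLp.inner_apply, Fin.sum_univ_two, Complex.inner]
  ring

theorem pd_J {x : Plane} {φ : Plane → C2} (hφ : DifferentiableAt ℝ φ x) (i : Fin 2) :
    pd i (fun y => J (φ y)) x = J (pd i φ x) := by
  have := (Jclm.hasFDerivAt.comp x hφ.hasFDerivAt).fderiv
  have h2 : (fun y => J (φ y)) = Jclm ∘ φ := rfl
  rw [pd, h2, this]; rfl

theorem contDiffOn_J {U : Set Plane} {φ : Plane → C2} (h : ContDiffOn ℝ ∞ φ U) :
    ContDiffOn ℝ ∞ (fun y => J (φ y)) U :=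
  Jclm.contDiff.comp_contDiffOn h

/-! ### Lagrangian charts -/

/-- A smooth Lagrangian immersion of an open subset of the parameter plane. -/
structure IsLagrangianChart (u : Plane → C2) (U : Set Plane) : Prop where
  isOpen : IsOpen U
  contDiffOn : ContDiffOn ℝ ∞ u U
  det_ne_zero : ∀ y ∈ U, (metric u y).det ≠ 0
  inner_J : ∀ y ∈ U, ∀ i j, (inner ℝ (J (pd i u y)) (pd j u y) : ℝ) = 0

theorem metric_apply (u : Plane → C2) (x : Plane) (i j : Fin 2) :
    metric u x i j = inner ℝ (pd i u x) (pd j u x) := rfl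

theorem metric_symm (u : Plane → C2) (x : Plane) (i j : Fin 2) :
    metric u x i j = metric u x j i :=
  real_inner_comm (pd j u x) (pd i u x)

theorem metricInv_symm (u : Plane → C2) (x : Plane) (i j : Fin 2) :
    metricInv u x i j = metricInv u x j i := by
  have : (metric u x).transpose = metric u x := by
    ext a b; exact metric_symm u x b a
  have h2 : (metricInv u x).transpose = metricInv u x := by
    rw [metricInv, Matrix.transpose_nonsing_inv, this]
  exact congrFun (congrFun h2 j) i

theorem inner_normalPart_of_orthogonal {u : Plane → C2} {x : Plane} (V : C2) {W : C2}
    (hW : ∀ i, (inner ℝ (pd i u x) W : ℝ) = 0) :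
    (inner ℝ (normalPart u x V) W : ℝ) = inner ℝ V W := by
  simp [normalPart, inner_sub_left, inner_add_left, inner_smul_left, hW]

/-- A vector of `ℂ²` that is complex-orthogonal to a complex basis vanishes. -/
theorem eq_zero_of_inner_eq_zero {a : Fin 2 → C2} (hJ : (inner ℝ (J (a 0)) (a 1) : ℝ) = 0)
    (hdet : (inner ℝ (a 0) (a 0) : ℝ) * inner ℝ (a 1) (a 1)
      - inner ℝ (a 0) (a 1) * inner ℝ (a 0) (a 1) ≠ (0 : ℝ)) {V : C2}
    (h0 : ∀ i, (inner ℝ V (a i) : ℝ) = 0) (h1 : ∀ i, (inner ℝ V (J (a i)) : ℝ) = 0) : V = 0 := by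
  have hp : ∀ i, (starRingEnd ℂ) (a i 0) * V 0 + (starRingEnd ℂ) (a i 1) * V 1 = 0 := by
    intro i
    have e0 := h0 i
    have e1 := h1 i
    simp [J, PiLp.inner_apply, Fin.sum_univ_two, Complex.inner] at e0 e1
    apply Complex.ext
    · simp; linarith
    · simp; linarith
  -- `|d|²` is the Hermitian Gram determinant of `a 0, a 1`. Since `hJ` makes their Hermitian
  -- product real, it equals the real Gram determinant, so `d ≠ 0` and Cramer's rule applies to
  -- `hp`.
  set d : ℂ := a 0 0 * a 1 1 - a 0 1 * a 1 0 with hd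
  have hd0 : d ≠ 0 := by
    intro h
    apply hdet
    have hn : Complex.normSq d = 0 := by simp [h]
    rw [hd, Complex.normSq_apply] at hn
    simp only [J, PiLp.inner_apply, Fin.sum_univ_two, Complex.inner, PiLp.smul_apply, smul_eq_mul,
      Complex.mul_re, Complex.mul_im, Complex.sub_re, Complex.sub_im, Complex.conj_re,
      Complex.conj_im, Complex.I_re, Complex.I_im] at hJ hn ⊢
    linear_combination hn + (-((a 0 0).im * (a 1 0).re) + (a 0 0).re * (a 1 0).im
      + (-((a 0 1).im * (a 1 1).re) + (a 0 1).re * (a 1 1).im)) * hJ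
  have hd1 : (starRingEnd ℂ) d ≠ 0 := (map_ne_zero _).2 hd0
  have v0 : (starRingEnd ℂ) d * V 0 = 0 := by
    simp only [hd, map_sub, map_mul]
    linear_combination (starRingEnd ℂ) (a 1 1) * hp 0 - (starRingEnd ℂ) (a 0 1) * hp 1
  have v1 : (starRingEnd ℂ) d * V 1 = 0 := by
    simp only [hd, map_sub, map_mul]
    linear_combination -(starRingEnd ℂ) (a 1 0) * hp 0 + (starRingEnd ℂ) (a 0 0) * hp 1
  ext k
  fin_cases k
  · simpa [hd1] using v0
  · simpa [hd1] using v1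

/-! ### The frame `∂ᵢu, J ∂ᵢu` and smoothness of the geometric quantities -/

namespace IsLagrangianChart

variable {u : Plane → C2} {U : Set Plane} {x : Plane} (hu : IsLagrangianChart u U) (hx : x ∈ U)

include hu

theorem contDiffOn_tangent (i : Fin 2) : ContDiffOn ℝ ∞ (pd i u) U :=
  contDiffOn_pd hu.isOpen hu.contDiffOn i

theorem contDiffOn_metric (i j : Fin 2) : ContDiffOn ℝ ∞ (fun y => metric u y i j) U :=
  (hu.contDiffOn_tangent i).inner ℝ (hu.contDiffOn_tangent j)

theorem contDiffOn_metricInv (i j : Fin 2) : ContDiffOn ℝ ∞ (fun y => metricInv u y i j) U := by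
  have hdet : ContDiffOn ℝ ∞ (fun y => (metric u y).det) U := by
    simp only [Matrix.det_fin_two]
    exact ((hu.contDiffOn_metric 0 0).mul (hu.contDiffOn_metric 1 1)).sub
      ((hu.contDiffOn_metric 0 1).mul (hu.contDiffOn_metric 1 0))
  have hadj : ContDiffOn ℝ ∞ (fun y => (metric u y).adjugate i j) U := by
    simp only [Matrix.adjugate_fin_two]
    fin_cases i <;> fin_cases j
    · exact hu.contDiffOn_metric 1 1
    · exact (hu.contDiffOn_metric 0 1).neg
    · exact (hu.contDiffOn_metric 1 0).neg
    · exact hu.contDiffOn_metric 0 0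
  have : (fun y => metricInv u y i j)
      = fun y => ((metric u y).det)⁻¹ * (metric u y).adjugate i j := by
    funext y
    simp [metricInv, Matrix.inv_def]
  rw [this]
  exact (hdet.inv hu.det_ne_zero).mul hadj

theorem contDiffOn_tangComp {V : Plane → C2} (hV : ContDiffOn ℝ ∞ V U) (i : Fin 2) :
    ContDiffOn ℝ ∞ (fun y => tangComp u y (V y) i) U :=
  ContDiffOn.sum fun k _ => (hu.contDiffOn_metricInv i k).mul
    (hV.inner ℝ (hu.contDiffOn_tangent k))

theorem contDiffOn_normalPart {V : Plane → C2} (hV : ContDiffOn ℝ ∞ V U) :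
    ContDiffOn ℝ ∞ (fun y => normalPart u y (V y)) U :=
  hV.sub (ContDiffOn.sum fun i _ => (hu.contDiffOn_tangComp hV i).smul (hu.contDiffOn_tangent i))

theorem contDiffOn_secondFF (i j : Fin 2) : ContDiffOn ℝ ∞ (secondFF u i j) U :=
  hu.contDiffOn_normalPart (contDiffOn_pd hu.isOpen (hu.contDiffOn_tangent j) i)

theorem contDiffOn_meanCurv : ContDiffOn ℝ ∞ (meanCurv u) U :=
  ContDiffOn.sum fun i _ => ContDiffOn.sum fun j _ =>
    (hu.contDiffOn_metricInv i j).smul (hu.contDiffOn_secondFF i j)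

theorem contDiffOn_christoffel (k i j : Fin 2) : ContDiffOn ℝ ∞ (christoffel u k i j) U :=
  contDiffOn_const.mul <| ContDiffOn.sum fun l _ => (hu.contDiffOn_metricInv k l).mul <|
    ((contDiffOn_pd hu.isOpen (hu.contDiffOn_metric j l) i).add
      (contDiffOn_pd hu.isOpen (hu.contDiffOn_metric i l) j)).sub
      (contDiffOn_pd hu.isOpen (hu.contDiffOn_metric i j) l)

theorem contDiffOn_covDerivForm {θ : Fin 2 → Plane → ℝ} (hθ : ∀ i, ContDiffOn ℝ ∞ (θ i) U)
    (i j : Fin 2) : ContDiffOn ℝ ∞ (covDerivForm u θ i j) U :=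
  (contDiffOn_pd hu.isOpen (hθ j) i).sub <| ContDiffOn.sum fun k _ =>
    (hu.contDiffOn_christoffel k i j).mul (hθ k)

include hx

theorem metricInv_mul (i j : Fin 2) :
    ∑ k, metricInv u x i k * metric u x k j = if i = j then 1 else 0 := by
  have h := Matrix.nonsing_inv_mul (metric u x) (Ne.isUnit (hu.det_ne_zero x hx))
  have := congrFun (congrFun h i) j
  rwa [Matrix.mul_apply, Matrix.one_apply] at this

theorem inner_J_tangent (i j : Fin 2) : (inner ℝ (pd i u x) (J (pd j u x)) : ℝ) = 0 := by
  rw [real_inner_comm]; exact hu.inner_J x hx j i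

/-- The four vectors `∂ᵢu, J ∂ᵢu` span `ℂ²` over `ℝ`, by the Lagrangian and immersion conditions.
Vector identities are tested against this frame. -/
theorem normal_ext {V W : C2} (h0 : ∀ i, (inner ℝ V (pd i u x) : ℝ) = inner ℝ W (pd i u x))
    (h1 : ∀ i, (inner ℝ V (J (pd i u x)) : ℝ) = inner ℝ W (J (pd i u x))) : V = W := by
  rw [← sub_eq_zero]
  refine eq_zero_of_inner_eq_zero (a := fun i => pd i u x) (hu.inner_J x hx 0 1) ?_
    (fun i => ?_) (fun i => ?_)
  · have := hu.det_ne_zero x hx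
    rw [Matrix.det_fin_two, metric_symm u x 1 0] at this
    exact this
  · rw [inner_sub_left, h0, sub_self]
  · rw [inner_sub_left, h1, sub_self]

theorem sum_tangComp_mul_metric (V : C2) (j : Fin 2) :
    ∑ i, tangComp u x V i * metric u x i j = inner ℝ V (pd j u x) := by
  have h0 := hu.metricInv_mul hx 0 j
  have h1 := hu.metricInv_mul hx 1 j
  simp only [tangComp, Fin.sum_univ_two] at *
  rw [metricInv_symm u x 1 0] at h1 ⊢
  fin_cases j <;> simp at h0 h1 ⊢ <;>
    linear_combination (inner ℝ V (pd 0 u x)) * h0 + (inner ℝ V (pd 1 u x)) * h1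

theorem inner_normalPart_tangent (V : C2) (j : Fin 2) :
    (inner ℝ (normalPart u x V) (pd j u x) : ℝ) = 0 := by
  simp only [normalPart, inner_sub_left, sum_inner, inner_smul_left, RCLike.conj_to_real,
    ← metric_apply, hu.sum_tangComp_mul_metric hx, sub_self]

theorem inner_normalPart_J (V : C2) (j : Fin 2) :
    (inner ℝ (normalPart u x V) (J (pd j u x)) : ℝ) = inner ℝ V (J (pd j u x)) :=
  inner_normalPart_of_orthogonal V fun i => hu.inner_J_tangent hx i j

/-- The fields `J ∂ᵢu` frame the normal bundle, and their Gram matrix is again `g` because `J` is an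
isometry. -/
theorem normal_expansion {V : C2} (hV : ∀ i, (inner ℝ V (pd i u x) : ℝ) = 0) :
    V = ∑ i, (∑ j, metricInv u x i j * inner ℝ V (J (pd j u x))) • J (pd i u x) := by
  refine hu.normal_ext hx (fun k => ?_) fun k => ?_
  · simp [hV, inner_add_left, inner_smul_left, hu.inner_J x hx]
  · have h0 := hu.metricInv_mul hx 0 k
    have h1 := hu.metricInv_mul hx 1 k
    simp only [inner_add_left, inner_smul_left, inner_J_J, ← metric_apply, RCLike.conj_to_real,
      Fin.sum_univ_two] at *
    rw [metricInv_symm u x 1 0] at h1 ⊢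
    fin_cases k <;> simp at h0 h1 ⊢ <;>
      linear_combination -(inner ℝ V (J (pd 0 u x))) * h0 - (inner ℝ V (J (pd 1 u x))) * h1

theorem tangent_expansion {V : C2} (hV : ∀ i, (inner ℝ V (J (pd i u x)) : ℝ) = 0) :
    V = ∑ i, tangComp u x V i • pd i u x := by
  refine hu.normal_ext hx (fun k => ?_) fun k => ?_
  · simp only [sum_inner, inner_smul_left, RCLike.conj_to_real, ← metric_apply,
      hu.sum_tangComp_mul_metric hx]
  · simp [hV, inner_add_left, inner_smul_left, hu.inner_J_tangent hx]

end IsLagrangianChart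

/-! ### The Levi-Civita connection -/

namespace IsLagrangianChart

variable {u : Plane → C2} {U : Set Plane} {x : Plane} (hu : IsLagrangianChart u U) (hx : x ∈ U)

include hu hx

theorem differentiableAt {V : Type*} [NormedAddCommGroup V] [NormedSpace ℝ V] {φ : Plane → V}
    (hφ : ContDiffOn ℝ ∞ φ U) : DifferentiableAt ℝ φ x :=
  differentiableAt_of_contDiffOn hu.isOpen hx hφ

theorem pd_pd_comm (i j : Fin 2) : pd i (pd j u) x = pd j (pd i u) x :=
  pd_comm hu.isOpen hx hu.contDiffOn i j

theorem pd_metric (k i j : Fin 2) : pd k (fun y => metric u y i j) x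
    = inner ℝ (pd k (pd i u) x) (pd j u x) + inner ℝ (pd i u x) (pd k (pd j u) x) :=
  pd_inner (hu.differentiableAt hx (hu.contDiffOn_tangent i))
    (hu.differentiableAt hx (hu.contDiffOn_tangent j)) k

/-- The ambient connection is flat, so in the Koszul combination of metric derivatives everything
cancels except `2⟨∂ᵢ∂ⱼu, ∂ₗu⟩`. -/
theorem christoffel_eq (k i j : Fin 2) :
    christoffel u k i j x = tangComp u x (pd i (pd j u) x) k := by
  simp only [christoffel, tangComp, hu.pd_metric hx, Finset.mul_sum]
  refine Finset.sum_congr rfl fun l _ => ?_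
  rw [hu.pd_pd_comm hx j i, hu.pd_pd_comm hx l i, hu.pd_pd_comm hx l j,
    real_inner_comm _ (pd j u x), real_inner_comm _ (pd i u x)]
  ring

theorem christoffel_symm (k i j : Fin 2) : christoffel u k i j x = christoffel u k j i x := by
  rw [hu.christoffel_eq hx, hu.christoffel_eq hx, hu.pd_pd_comm hx]

theorem pd_pd_eq (i j : Fin 2) : pd i (pd j u) x
    = secondFF u i j x + ∑ k, christoffel u k i j x • pd k u x := by
  simp only [secondFF, normalPart, hu.christoffel_eq hx, sub_add_cancel]

theorem sum_christoffel_mul_metric (i j k : Fin 2) :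
    ∑ l, christoffel u l i j x * metric u x l k = inner ℝ (pd i (pd j u) x) (pd k u x) := by
  simp only [hu.christoffel_eq hx, hu.sum_tangComp_mul_metric hx]

theorem pd_metric_eq_christoffel (k i j : Fin 2) : pd k (fun y => metric u y i j) x
    = ∑ l, christoffel u l k i x * metric u x l j + ∑ l, christoffel u l k j x * metric u x i l := by
  rw [hu.pd_metric hx, ← hu.sum_christoffel_mul_metric hx, real_inner_comm,
    ← hu.sum_christoffel_mul_metric hx]
  simp only [metric_symm u x i]

/-- This is `∇g⁻¹ = 0`: differentiate `g⁻¹g = 1` and insert the metric compatibility of `Γ`. -/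
theorem pd_metricInv (k i j : Fin 2) : pd k (fun y => metricInv u y i j) x
    = -∑ l, (christoffel u i k l x * metricInv u x l j
        + christoffel u j k l x * metricInv u x i l) := by
  set g := metric u x with hg
  set h := metricInv u x with hh
  let dg : Matrix (Fin 2) (Fin 2) ℝ := Matrix.of fun a b => pd k (fun y => metric u y a b) x
  let dh : Matrix (Fin 2) (Fin 2) ℝ := Matrix.of fun a b => pd k (fun y => metricInv u y a b) x
  let G : Matrix (Fin 2) (Fin 2) ℝ := Matrix.of fun a b => christoffel u a k b x
  have hdet : IsUnit g.det := Ne.isUnit (hu.det_ne_zero x hx)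
  have hinv : h * g = 1 := Matrix.nonsing_inv_mul g hdet
  have hdg : dg = G.transpose * g + g * G := by
    ext a b
    simp only [dg, G, Matrix.add_apply, Matrix.mul_apply, Matrix.of_apply,
      Matrix.transpose_apply, hu.pd_metric_eq_christoffel hx]
    congr 1
    exact Finset.sum_congr rfl fun l _ => mul_comm _ _
  have hprod : dh * g + h * dg = 0 := by
    ext a b
    have h1 : pd k (fun y => ∑ m, metricInv u y a m * metric u y m b) x = 0 := by
      rw [pd_congr hu.isOpen hx fun y hy => hu.metricInv_mul hy a b]
      exact pd_const _ _
    rw [pd_sum fun m _ => (hu.differentiableAt hx (hu.contDiffOn_metricInv a m)).fun_mul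
      (hu.differentiableAt hx (hu.contDiffOn_metric m b))] at h1
    simp only [pd_mul (hu.differentiableAt hx (hu.contDiffOn_metricInv _ _))
      (hu.differentiableAt hx (hu.contDiffOn_metric _ _)), Finset.sum_add_distrib] at h1
    exact h1
  have hE : (dh + (G * h + h * G.transpose)) * g = 0 := by
    have : (dh + (G * h + h * G.transpose)) * g
        = (dh * g + h * dg) + (G * (h * g) - (h * g) * G) := by
      rw [hdg]; noncomm_ring
    rw [this, hprod, hinv]; simp
  have hE' : dh + (G * h + h * G.transpose) = 0 := by
    have h1 : g * h = 1 := Matrix.mul_nonsing_inv g hdet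
    have := congrArg (· * h) hE
    simpa only [Matrix.mul_assoc, h1, Matrix.mul_one, Matrix.zero_mul] using this
  have := Matrix.ext_iff.2 (eq_neg_of_add_eq_zero_left hE') i j
  simp only [dh, G, Matrix.neg_apply, Matrix.add_apply, Matrix.mul_apply, Matrix.of_apply,
    Matrix.transpose_apply] at this
  rw [this, Finset.sum_add_distrib]
  congr 2
  exact Finset.sum_congr rfl fun l _ => mul_comm _ _

/-- Since `g⁻¹` is parallel, raising an index commutes with `∇`, and the divergence is the trace of
the derivative of the dual one-form. -/
theorem divergence_eq {V : Plane → C2} (hV : ContDiffOn ℝ ∞ V U) :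
    divergence u V x = ∑ i, ∑ j, metricInv u x i j
      * covDerivForm u (fun j y => inner ℝ (V y) (pd j u y)) i j x := by
  have hd : ∀ j, DifferentiableAt ℝ (fun y => (inner ℝ (V y) (pd j u y) : ℝ)) x := fun j =>
    hu.differentiableAt hx (hV.inner ℝ (hu.contDiffOn_tangent j))
  have hp : ∀ i, pd i (fun y => tangComp u y (V y) i) x
      = ∑ k, (pd i (fun y => metricInv u y i k) x * inner ℝ (V x) (pd k u x)
        + metricInv u x i k * pd i (fun y => (inner ℝ (V y) (pd k u y) : ℝ)) x) := by
    intro i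
    simp only [tangComp]
    rw [pd_sum fun k _ => (hu.differentiableAt hx (hu.contDiffOn_metricInv i k)).fun_mul (hd k)]
    exact Finset.sum_congr rfl fun k _ =>
      pd_mul (hu.differentiableAt hx (hu.contDiffOn_metricInv i k)) (hd k) i
  simp only [divergence, hp, covDerivForm]
  simp only [hu.pd_metricInv hx, tangComp, Fin.sum_univ_two,
    metricInv_symm u x 1 0, hu.christoffel_symm hx _ 1 0]
  ring

theorem pd_trace {S : Fin 2 → Fin 2 → Plane → ℝ} (hS : ∀ i j, ContDiffOn ℝ ∞ (S i j) U)
    (k : Fin 2) : pd k (fun y => ∑ i, ∑ j, metricInv u y i j * S i j y) x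
      = ∑ i, ∑ j, metricInv u x i j * covDerivTensor u S k i j x := by
  have hd : ∀ i j, DifferentiableAt ℝ (S i j) x := fun i j => hu.differentiableAt hx (hS i j)
  have hh : ∀ i j, DifferentiableAt ℝ (fun y => metricInv u y i j) x := fun i j =>
    hu.differentiableAt hx (hu.contDiffOn_metricInv i j)
  have hp : pd k (fun y => ∑ i, ∑ j, metricInv u y i j * S i j y) x
      = ∑ i, ∑ j, (pd k (fun y => metricInv u y i j) x * S i j x
        + metricInv u x i j * pd k (S i j) x) := by
    rw [pd_sum fun i _ => DifferentiableAt.fun_sum fun j _ => (hh i j).fun_mul (hd i j)]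
    refine Finset.sum_congr rfl fun i _ => ?_
    rw [pd_sum fun j _ => (hh i j).fun_mul (hd i j)]
    exact Finset.sum_congr rfl fun j _ => pd_mul (hh i j) (hd i j) k
  rw [hp]
  simp only [hu.pd_metricInv hx, covDerivTensor, Fin.sum_univ_two]
  ring

theorem covDerivTensor_smul_metric {c : Plane → ℝ} (hc : ContDiffOn ℝ ∞ c U) (i j k : Fin 2) :
    covDerivTensor u (fun a b y => c y * metric u y a b) i j k x = pd i c x * metric u x j k := by
  simp only [covDerivTensor]
  rw [pd_mul (hu.differentiableAt hx hc) (hu.differentiableAt hx (hu.contDiffOn_metric j k)),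
    hu.pd_metric_eq_christoffel hx]
  simp only [Fin.sum_univ_two]
  ring

theorem covDerivTensor_sub {S T : Fin 2 → Fin 2 → Plane → ℝ}
    (hS : ∀ i j, ContDiffOn ℝ ∞ (S i j) U) (hT : ∀ i j, ContDiffOn ℝ ∞ (T i j) U)
    (i j k : Fin 2) : covDerivTensor u (fun a b y => S a b y - T a b y) i j k x
      = covDerivTensor u S i j k x - covDerivTensor u T i j k x := by
  simp only [covDerivTensor]
  rw [pd_sub (hu.differentiableAt hx (hS j k)) (hu.differentiableAt hx (hT j k))]
  simp only [Fin.sum_univ_two]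
  ring

end IsLagrangianChart

/-! ### The second fundamental form of a Lagrangian surface -/

theorem contract_eq_inner (u V : Plane → C2) (i : Fin 2) (x : Plane) :
    contract u V i x = inner ℝ (J (V x)) (pd i u x) :=
  omega_eq_inner _ _

theorem inner_meanCurv (u : Plane → C2) (x : Plane) (W : C2) : (inner ℝ (meanCurv u x) W : ℝ)
    = ∑ i, ∑ j, metricInv u x i j * inner ℝ (secondFF u i j x) W := by
  simp only [meanCurv, sum_inner, inner_smul_left, RCLike.conj_to_real]

namespace IsLagrangianChart

variable {u : Plane → C2} {U : Set Plane} {x : Plane} (hu : IsLagrangianChart u U) (hx : x ∈ U)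

include hu hx

theorem inner_tangent_normal {V N : C2} (hV : ∀ i, (inner ℝ V (J (pd i u x)) : ℝ) = 0)
    (hN : ∀ i, (inner ℝ N (pd i u x) : ℝ) = 0) : (inner ℝ V N : ℝ) = 0 := by
  rw [hu.tangent_expansion hx hV]
  rw [real_inner_comm]
  simp only [inner_sum, inner_smul_right, hN, mul_zero, Finset.sum_const_zero]

theorem inner_normal_J_normal {N N' : C2} (hN : ∀ i, (inner ℝ N (pd i u x) : ℝ) = 0)
    (hN' : ∀ i, (inner ℝ N' (pd i u x) : ℝ) = 0) : (inner ℝ N (J N') : ℝ) = 0 := by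
  rw [real_inner_comm]
  exact hu.inner_tangent_normal hx (fun i => by rw [inner_J_J, hN']) hN

theorem inner_secondFF_tangent (i j k : Fin 2) :
    (inner ℝ (secondFF u i j x) (pd k u x) : ℝ) = 0 :=
  hu.inner_normalPart_tangent hx _ k

theorem inner_secondFF_J (i j k : Fin 2) : (inner ℝ (secondFF u i j x) (J (pd k u x)) : ℝ)
    = inner ℝ (pd i (pd j u) x) (J (pd k u x)) :=
  hu.inner_normalPart_J hx _ k

theorem secondFF_symm (i j : Fin 2) : secondFF u i j x = secondFF u j i x := by
  rw [secondFF, secondFF, hu.pd_pd_comm hx]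

/-- The cubic form `⟨A(∂ᵢ, ∂ⱼ), J ∂ₖ⟩` is totally symmetric. -/
theorem inner_secondFF_J_symm (i j k : Fin 2) :
    (inner ℝ (secondFF u i j x) (J (pd k u x)) : ℝ)
      = inner ℝ (secondFF u i k x) (J (pd j u x)) := by
  -- Symmetry in the last two slots comes from differentiating the Lagrangian condition `⟨J ∂ⱼu,
  -- ∂ₖu⟩ = 0`; symmetry in the first two is that of second derivatives.
  have hJ : pd i (fun y => (inner ℝ (J (pd j u y)) (pd k u y) : ℝ)) x = 0 := by
    rw [pd_congr hu.isOpen hx fun y hy => hu.inner_J y hy j k]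
    exact pd_const _ _
  rw [pd_inner (hu.differentiableAt hx (contDiffOn_J (hu.contDiffOn_tangent j)))
    (hu.differentiableAt hx (hu.contDiffOn_tangent k)),
    pd_J (hu.differentiableAt hx (hu.contDiffOn_tangent j)), inner_J_left,
    real_inner_comm] at hJ
  rw [hu.inner_secondFF_J hx, hu.inner_secondFF_J hx]
  linarith [real_inner_comm (J (pd k u x)) (pd i (pd j u) x),
    real_inner_comm (J (pd j u x)) (pd i (pd k u) x)]

theorem inner_meanCurv_tangent (k : Fin 2) : (inner ℝ (meanCurv u x) (pd k u x) : ℝ) = 0 := by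
  simp only [meanCurv, sum_inner, inner_smul_left, hu.inner_secondFF_tangent hx, mul_zero,
    Finset.sum_const_zero]

theorem inner_J_meanCurv_J (k : Fin 2) :
    (inner ℝ (J (meanCurv u x)) (J (pd k u x)) : ℝ) = 0 := by
  rw [inner_J_J, hu.inner_meanCurv_tangent hx]

/-- Split both factors into tangential and normal parts. `J` sends each plane to the other, so only
the mixed products survive. -/
theorem inner_pd_pd_J_pd_pd (i j k l : Fin 2) :
    (inner ℝ (pd j (pd k u) x) (J (pd i (pd l u) x)) : ℝ)
      = ∑ m, christoffel u m i l x * inner ℝ (secondFF u j k x) (J (pd m u x))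
        - ∑ m, christoffel u m j k x * inner ℝ (secondFF u i l x) (J (pd m u x)) := by
  have h1 : ∀ m, (inner ℝ (pd m u x) (J (secondFF u i l x)) : ℝ)
      = - inner ℝ (secondFF u i l x) (J (pd m u x)) := fun m => by
    rw [real_inner_comm, inner_J_left]
  rw [hu.pd_pd_eq hx j k, hu.pd_pd_eq hx i l]
  simp only [J_add, J_sum, J_smul, inner_add_left, inner_add_right, sum_inner, inner_sum,
    inner_smul_left, inner_smul_right, RCLike.conj_to_real, hu.inner_J_tangent hx, h1,
    hu.inner_normal_J_normal hx (hu.inner_secondFF_tangent hx j k)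
      (hu.inner_secondFF_tangent hx i l)]
  simp only [Fin.sum_univ_two]
  ring

/-! ### The mean curvature form -/

omit hx in
theorem contDiffOn_contract_meanCurv (j : Fin 2) :
    ContDiffOn ℝ ∞ (contract u (meanCurv u) j) U := by
  have : contract u (meanCurv u) j
      = fun y => (inner ℝ (J (meanCurv u y)) (pd j u y) : ℝ) :=
    funext fun y => contract_eq_inner u _ j y
  rw [this]
  exact (contDiffOn_J hu.contDiffOn_meanCurv).inner ℝ (hu.contDiffOn_tangent j)

theorem pd_contract_meanCurv (i j : Fin 2) : pd i (contract u (meanCurv u) j) x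
    = inner ℝ (pd i (fun y => J (meanCurv u y)) x) (pd j u x)
      + inner ℝ (J (meanCurv u x)) (pd i (pd j u) x) := by
  rw [pd_congr hu.isOpen hx fun y _ => contract_eq_inner u (meanCurv u) j y]
  exact pd_inner (hu.differentiableAt hx (contDiffOn_J hu.contDiffOn_meanCurv))
    (hu.differentiableAt hx (hu.contDiffOn_tangent j)) i

/-- `JH` is tangential, hence orthogonal to `A_{ij}`; the Christoffel part of `∂ᵢ∂ⱼu` cancels the
connection term. -/
theorem covDerivForm_meanCurv (i j : Fin 2) :
    covDerivForm u (contract u (meanCurv u)) i j x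
      = inner ℝ (pd i (fun y => J (meanCurv u y)) x) (pd j u x) := by
  have h0 : (inner ℝ (J (meanCurv u x)) (secondFF u i j x) : ℝ) = 0 :=
    hu.inner_tangent_normal hx (hu.inner_J_meanCurv_J hx) (hu.inner_secondFF_tangent hx i j)
  rw [covDerivForm, hu.pd_contract_meanCurv hx, hu.pd_pd_eq hx]
  simp only [inner_add_right, inner_sum, inner_smul_right, h0, contract_eq_inner]
  ring

/-- Total symmetry of the cubic form moves the free index `j` into a derivative slot, so that in
`dθ` the third derivatives of `u` cancel. -/
theorem contract_meanCurv_eq (j : Fin 2) : contract u (meanCurv u) j x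
    = ∑ k, ∑ l, metricInv u x k l * -(inner ℝ (pd j (pd k u) x) (J (pd l u x)) : ℝ) := by
  rw [contract_eq_inner, inner_J_left, inner_meanCurv]
  simp only [mul_neg, Finset.sum_neg_distrib]
  congr 1
  refine Finset.sum_congr rfl fun k _ => Finset.sum_congr rfl fun l _ => ?_
  rw [← hu.inner_secondFF_J hx, hu.inner_secondFF_J_symm hx k l j, hu.secondFF_symm hx k j,
    hu.inner_secondFF_J_symm hx j k l, hu.secondFF_symm hx j l, hu.inner_secondFF_J_symm hx l j k,
    hu.secondFF_symm hx l k]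

/-- After the third derivatives cancel, the remaining terms are Christoffel symbols times the cubic
form; those from `∂g⁻¹` cancel those from `⟨∂∂u, J ∂∂u⟩`. -/
theorem closed_meanCurv :
    pd 0 (contract u (meanCurv u) 1) x = pd 1 (contract u (meanCurv u) 0) x := by
  have hD : ∀ j k, ContDiffOn ℝ ∞ (pd j (pd k u)) U := fun j k =>
    contDiffOn_pd hu.isOpen (hu.contDiffOn_tangent k) j
  have hc : ∀ j k l, ContDiffOn ℝ ∞
      (fun y => -(inner ℝ (pd j (pd k u) y) (J (pd l u y)) : ℝ)) U := fun j k l =>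
    ((hD j k).inner ℝ (contDiffOn_J (hu.contDiffOn_tangent l))).neg
  have hpc : ∀ i j k l, pd i (fun y => -(inner ℝ (pd j (pd k u) y) (J (pd l u y)) : ℝ)) x
      = -inner ℝ (pd i (pd j (pd k u)) x) (J (pd l u x))
        - inner ℝ (pd j (pd k u) x) (J (pd i (pd l u) x)) := by
    intro i j k l
    have h1 := pd_inner (hu.differentiableAt hx (hD j k))
      (hu.differentiableAt hx (contDiffOn_J (hu.contDiffOn_tangent l))) i
    have h2 : pd i (fun y => -(inner ℝ (pd j (pd k u) y) (J (pd l u y)) : ℝ)) x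
        = -pd i (fun y => (inner ℝ (pd j (pd k u) y) (J (pd l u y)) : ℝ)) x := by
      simp [pd]
    rw [h2, h1, pd_J (hu.differentiableAt hx (hu.contDiffOn_tangent l))]
    ring
  have key : ∀ i j, pd i (contract u (meanCurv u) j) x
      = ∑ k, ∑ l, (pd i (fun y => metricInv u y k l) x
          * -(inner ℝ (pd j (pd k u) x) (J (pd l u x)) : ℝ)
        + metricInv u x k l * (-inner ℝ (pd i (pd j (pd k u)) x) (J (pd l u x))
        - inner ℝ (pd j (pd k u) x) (J (pd i (pd l u) x)))) := by
    intro i j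
    have hm : ∀ k l, DifferentiableAt ℝ (fun y => metricInv u y k l
        * -(inner ℝ (pd j (pd k u) y) (J (pd l u y)) : ℝ)) x := fun k l =>
      hu.differentiableAt hx ((hu.contDiffOn_metricInv k l).mul (hc j k l))
    rw [pd_congr hu.isOpen hx fun y hy => hu.contract_meanCurv_eq hy j,
      pd_sum fun k _ => DifferentiableAt.fun_sum fun l _ => hm k l]
    refine Finset.sum_congr rfl fun k _ => ?_
    rw [pd_sum fun l _ => hm k l]
    refine Finset.sum_congr rfl fun l _ => ?_
    rw [pd_mul (hu.differentiableAt hx (hu.contDiffOn_metricInv k l))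
      (hu.differentiableAt hx (hc j k l)), hpc]
  have h3 : ∀ k, pd 1 (pd 0 (pd k u)) x = pd 0 (pd 1 (pd k u)) x := fun k =>
    pd_comm hu.isOpen hx (hu.contDiffOn_tangent k) 1 0
  rw [key, key]
  simp only [hu.inner_pd_pd_J_pd_pd hx, ← hu.inner_secondFF_J hx, hu.pd_metricInv hx, h3,
    Fin.sum_univ_two, metricInv_symm u x 1 0, hu.christoffel_symm hx _ 1 0,
    hu.secondFF_symm hx 1 0, hu.inner_secondFF_J_symm hx 0 1 0]
  rw [← hu.inner_secondFF_J_symm hx 1 0 1, hu.secondFF_symm hx 1 0]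
  ring

theorem covDerivForm_meanCurv_symm (i j : Fin 2) :
    covDerivForm u (contract u (meanCurv u)) i j x
      = covDerivForm u (contract u (meanCurv u)) j i x := by
  have h : ∀ i j, pd i (contract u (meanCurv u) j) x = pd j (contract u (meanCurv u) i) x := by
    intro i j
    fin_cases i <;> fin_cases j
    · rfl
    · exact hu.closed_meanCurv hx
    · exact (hu.closed_meanCurv hx).symm
    · rfl
  simp only [covDerivForm, h i j, hu.christoffel_symm hx _ i j]

/-! ### The Laplacian of `H` as a divergence, and commuting derivatives -/

theorem contract_normalLaplacian_meanCurv (k : Fin 2) :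
    contract u (normalLaplacian u (meanCurv u)) k x = ∑ i, ∑ j, metricInv u x i j
      * covDerivTensor u (covDerivForm u (contract u (meanCurv u))) i j k x := by
  set B := covDerivForm u (contract u (meanCurv u)) with hB
  have hH := hu.contDiffOn_meanCurv
  have hN : ∀ j, ContDiffOn ℝ ∞ (normalDeriv u (meanCurv u) j) U := fun j =>
    hu.contDiffOn_normalPart (contDiffOn_pd hu.isOpen hH j)
  -- As `J` is parallel, the components of `∇H` in the frame `J ∂ₖu` are those of `-∇θ`; `hcov`
  -- repeats this one derivative higher.
  have hNJ : ∀ y ∈ U, ∀ j k,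
      (inner ℝ (normalDeriv u (meanCurv u) j y) (J (pd k u y)) : ℝ) = -B j k y := by
    intro y hy j k
    rw [normalDeriv, hu.inner_normalPart_J hy, hB, hu.covDerivForm_meanCurv hy,
      pd_J (hu.differentiableAt hy hH), inner_J_left, neg_neg]
  have hNt : ∀ j l, (inner ℝ (normalDeriv u (meanCurv u) j x) (pd l u x) : ℝ) = 0 :=
    fun j l => hu.inner_normalPart_tangent hx _ l
  have hcov : ∀ i j, (inner ℝ (normalDerivForm u (normalDeriv u (meanCurv u)) i j x)
      (J (pd k u x)) : ℝ) = -covDerivTensor u B i j k x := by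
    intro i j
    have h1 := pd_inner (hu.differentiableAt hx (hN j))
      (hu.differentiableAt hx (contDiffOn_J (hu.contDiffOn_tangent k))) i
    rw [pd_congr hu.isOpen hx fun y hy => hNJ y hy j k,
      pd_J (hu.differentiableAt hx (hu.contDiffOn_tangent k)), hu.pd_pd_eq hx] at h1
    have h2 : pd i (fun y => -B j k y) x = -pd i (B j k) x := by simp [pd]
    rw [h2] at h1
    simp only [J_add, J_sum, J_smul, inner_add_right, inner_sum, inner_smul_right, hNJ x hx,
      hu.inner_normal_J_normal hx (hNt j) (hu.inner_secondFF_tangent hx i k)] at h1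
    simp only [normalDerivForm, inner_sub_left, sum_inner, inner_smul_left,
      RCLike.conj_to_real, hNJ x hx, hu.inner_normalPart_J hx, covDerivTensor]
    simp only [Fin.sum_univ_two] at h1 ⊢
    linarith
  rw [contract_eq_inner, inner_J_left, normalLaplacian]
  simp only [sum_inner, inner_smul_left, RCLike.conj_to_real, hcov, mul_neg,
    Finset.sum_neg_distrib, neg_neg]

theorem divergence_J_meanCurv : divergence u (fun y => J (meanCurv u y)) x
    = ∑ i, ∑ j, metricInv u x i j * covDerivForm u (contract u (meanCurv u)) i j x := by
  rw [hu.divergence_eq hx (contDiffOn_J hu.contDiffOn_meanCurv)]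
  have : (fun j y => (inner ℝ (J (meanCurv u y)) (pd j u y) : ℝ)) = contract u (meanCurv u) :=
    funext fun j => funext fun y => (contract_eq_inner u _ j y).symm
  rw [this]

/-- Differentiate `JH = ∑ (JH)ˡ ∂ₗu`; against a normal vector only the second fundamental form
remains. -/
theorem inner_pd_J_meanCurv_normal {N : C2} (hN : ∀ i, (inner ℝ N (pd i u x) : ℝ) = 0)
    (k : Fin 2) : (inner ℝ (pd k (fun y => J (meanCurv u y)) x) N : ℝ)
      = ∑ l, tangComp u x (J (meanCurv u x)) l * inner ℝ (secondFF u k l x) N := by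
  have hV := contDiffOn_J hu.contDiffOn_meanCurv
  have hc : ∀ l, DifferentiableAt ℝ (fun y => tangComp u y (J (meanCurv u y)) l) x := fun l =>
    hu.differentiableAt hx (hu.contDiffOn_tangComp hV l)
  have ha : ∀ l, DifferentiableAt ℝ (pd l u) x := fun l =>
    hu.differentiableAt hx (hu.contDiffOn_tangent l)
  have hN' : ∀ i, (inner ℝ (pd i u x) N : ℝ) = 0 := fun i => by rw [real_inner_comm, hN]
  rw [pd_congr hu.isOpen hx fun y hy => hu.tangent_expansion hy (hu.inner_J_meanCurv_J hy),
    pd_sum fun l _ => (hc l).fun_smul (ha l)]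
  simp only [pd_smul (hc _) (ha _), hu.pd_pd_eq hx, sum_inner, inner_add_left, inner_smul_left,
    RCLike.conj_to_real, hN', mul_zero, Finset.sum_const_zero, zero_add, add_zero]

/-- The Ricci identity for the mean curvature form, with the curvature given by the Gauss
equation. -/
theorem covDerivTensor_commutator (i j k : Fin 2) :
    covDerivTensor u (covDerivForm u (contract u (meanCurv u))) i k j x
      - covDerivTensor u (covDerivForm u (contract u (meanCurv u))) k i j x
      = ∑ l, tangComp u x (J (meanCurv u x)) l
        * (inner ℝ (secondFF u k l x) (secondFF u i j x)
          - inner ℝ (secondFF u i l x) (secondFF u k j x)) := by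
  have hV := contDiffOn_J hu.contDiffOn_meanCurv
  have hp : ∀ i k j, pd i (covDerivForm u (contract u (meanCurv u)) k j) x
      = inner ℝ (pd i (pd k (fun y => J (meanCurv u y))) x) (pd j u x)
        + (inner ℝ (pd k (fun y => J (meanCurv u y)) x) (secondFF u i j x)
        + ∑ l, christoffel u l i j x * covDerivForm u (contract u (meanCurv u)) k l x) := by
    intro i k j
    rw [pd_congr hu.isOpen hx fun y hy => hu.covDerivForm_meanCurv hy k j,
      pd_inner (hu.differentiableAt hx (contDiffOn_pd hu.isOpen hV k))
        (hu.differentiableAt hx (hu.contDiffOn_tangent j)), hu.pd_pd_eq hx]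
    simp only [inner_add_right, inner_sum, inner_smul_right, hu.covDerivForm_meanCurv hx]
  -- The second derivatives of `JH` commute because the ambient space is flat, and the Christoffel
  -- terms cancel. What is left is quadratic in `A`, so no curvature tensor is needed.
  simp only [covDerivTensor, hp, pd_comm hu.isOpen hx hV k i,
    hu.inner_pd_J_meanCurv_normal hx (hu.inner_secondFF_tangent hx _ _),
    hu.christoffel_symm hx _ k i]
  simp only [Fin.sum_univ_two]
  ring

end IsLagrangianChart

/-! ### Contractions of symmetric cubic forms in dimension two -/

section CubicForms

variable {c : Fin 2 → Fin 2 → Fin 2 → ℝ} {g h : Fin 2 → Fin 2 → ℝ} {η : Fin 2 → ℝ}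
  {s : Fin 2 → Fin 2 → ℝ} {n : ℝ}

/-- The algebraic identity relating the two trace-free parts of a symmetric cubic form `c` with
trace `η`, where `g` is the inverse of `h`. -/
theorem cubic_form_identity
    (hc : ∀ i j k, c i j k = c j i k) (hc' : ∀ i j k, c i j k = c i k j)
    (hh : h 1 0 = h 0 1) (hdet : h 0 0 * h 1 1 - h 0 1 * h 0 1 ≠ 0)
    (hg : ∀ i j, g i j = (h 0 0 * h 1 1 - h 0 1 * h 0 1)⁻¹
      * (!![h 1 1, -h 0 1; -h 0 1, h 0 0] : Matrix (Fin 2) (Fin 2) ℝ) i j)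
    (hη : ∀ k, η k = ∑ i, ∑ j, h i j * c i j k)
    (hs : ∀ i j, s i j = ∑ k, ∑ l, h k l * η l * c i j k)
    (hn : n = ∑ i, ∑ j, h i j * η i * η j) (m : Fin 2) :
    ∑ i, ∑ j, ∑ k, ∑ l, (h i k * h j l * (s k l - (1 / 2) * g k l * n))
        * (c i j m - (1 / 2) * g i j * η m)
      = (1 / 8) * n * η m
        + ∑ i, ∑ j, ∑ k, ∑ l, (h i k * h j l * (s k l - (1 / 4) * (g k l * n + 2 * η k * η l)))
          * (c i j m - (1 / 4) * (g i j * η m + η i * g j m + η j * g i m))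
        + ∑ i, ∑ j, ((∑ k, h i k * -η k) * (∑ k, h j k * -η k))
          * (c i j m - (1 / 4) * (g i j * η m + η i * g j m + η j * g i m)) := by
  have e1 := hc' 0 1 0
  have e2 := hc 1 0 0
  have e3 := hc 1 0 1
  have e4 := hc' 1 1 0
  simp only [hn, hs, hη, hg, Fin.sum_univ_two, e2, e1, e4, e3, hh, Matrix.of_apply,
    Matrix.cons_val', Matrix.cons_val_zero, Matrix.cons_val_one, Matrix.cons_val_fin_one]
  fin_cases m <;>
  simp only [e2, e1, e4, e3, Fin.zero_eta, Fin.mk_one] <;>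
  generalize c 0 0 0 = c0, c 0 0 1 = c1, c 0 1 1 = c2, c 1 1 1 = c3 at * <;>
  generalize h 0 0 = p, h 0 1 = q, h 1 1 = r at * <;>
  generalize hD : (p * r - q * q)⁻¹ = D <;>
  have : D * (p * r - q * q) = 1 := by rw [← hD]; exact inv_mul_cancel₀ hdet
  all_goals
    -- The two traces become atoms, tied to `c0, …, c3` by `hη0` and `hη1`; with `D` as the inverse
    -- determinant the goal is polynomial.
    generalize hη0 : p * c0 + q * c1 + (q * c1 + r * c2) = η0
    generalize hη1 : p * c1 + q * c2 + (q * c2 + r * c3) = η1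
    clear hD hh e1 e2 e3 e4 hc hc' hn hs hη hg hdet
    simp only [Matrix.cons_val_zero, Matrix.cons_val_one]
  all_goals grind (ringSteps := 1000000)

/-- The Lagrangian trace-free part of a symmetric cubic form with trace `η` has squared norm smaller
by `3 / 4 * |η|²`. -/
theorem cubic_form_norm
    (hc : ∀ i j k, c i j k = c j i k) (hc' : ∀ i j k, c i j k = c i k j)
    (hh : h 1 0 = h 0 1) (hdet : h 0 0 * h 1 1 - h 0 1 * h 0 1 ≠ 0)
    (hg : ∀ i j, g i j = (h 0 0 * h 1 1 - h 0 1 * h 0 1)⁻¹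
      * (!![h 1 1, -h 0 1; -h 0 1, h 0 0] : Matrix (Fin 2) (Fin 2) ℝ) i j)
    (hη : ∀ k, η k = ∑ i, ∑ j, h i j * c i j k)
    (hs : ∀ i j, s i j = ∑ k, ∑ l, h k l * η l * c i j k)
    (hn : n = ∑ i, ∑ j, h i j * η i * η j) :
    ∑ i, ∑ j, ∑ k, ∑ l, h i k * h j l *
      (-(1 / 4) * (g k l * s i j + η k * c i j l + η l * c i j k)
      - (1 / 4) * (g i j * s k l + η i * c k l j + η j * c k l i)
      + (1 / 16) * (g i j * g k l * n + 2 * g i j * η k * η l + 2 * g k l * η i * η j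
         + η i * η k * g j l + η i * η l * g j k + η j * η k * g i l + η j * η l * g i k))
      = -(3 / 4) * n := by
  have e1 := hc' 0 1 0
  have e2 := hc 1 0 0
  have e3 := hc 1 0 1
  have e4 := hc' 1 1 0
  simp only [hn, hs, hη, hg, Fin.sum_univ_two, e2, e1, e4, e3, hh, Matrix.of_apply,
    Matrix.cons_val', Matrix.cons_val_zero, Matrix.cons_val_one, Matrix.cons_val_fin_one]
  generalize c 0 0 0 = c0, c 0 0 1 = c1, c 0 1 1 = c2, c 1 1 1 = c3 at *
  generalize h 0 0 = p, h 0 1 = q, h 1 1 = r at *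
  generalize hD : (p * r - q * q)⁻¹ = D
  have : D * (p * r - q * q) = 1 := by rw [← hD]; exact inv_mul_cancel₀ hdet
  generalize hη0 : p * c0 + q * c1 + (q * c1 + r * c2) = η0
  generalize hη1 : p * c1 + q * c2 + (q * c2 + r * c3) = η1
  clear hD hh e1 e2 e3 e4
  grind

end CubicForms

/-! ### The Willmore operator of a Lagrangian surface -/

theorem inner_tracefreeA (u : Plane → C2) (x : Plane) (i j : Fin 2) (W : C2) :
    (inner ℝ (tracefreeA u i j x) W : ℝ) = inner ℝ (secondFF u i j x) W
      - (1 / 2) * metric u x i j * inner ℝ (meanCurv u x) W := by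
  simp only [tracefreeA, inner_sub_left, inner_smul_left, RCLike.conj_to_real]

theorem inner_checkA (u : Plane → C2) (x : Plane) (i j : Fin 2) (W : C2) :
    (inner ℝ (checkA u i j x) W : ℝ) = inner ℝ (secondFF u i j x) W
      - (1 / 4) * (metric u x i j * inner ℝ (meanCurv u x) W
        + inner ℝ (meanCurv u x) (J (pd i u x)) * inner ℝ (J (pd j u x)) W
        + inner ℝ (meanCurv u x) (J (pd j u x)) * inner ℝ (J (pd i u x)) W) := by
  simp only [checkA, inner_sub_left, inner_add_left, inner_smul_left, RCLike.conj_to_real,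
    real_inner_comm (meanCurv u x) (J _)]

theorem norm_meanCurv_sq (u : Plane → C2) (x : Plane) : ‖meanCurv u x‖ ^ 2
    = ∑ i, ∑ j, ∑ k, ∑ l, metricInv u x i j * metricInv u x k l
      * inner ℝ (secondFF u i j x) (secondFF u k l x) := by
  rw [← real_inner_self_eq_norm_sq, inner_meanCurv]
  simp only [real_inner_comm (meanCurv u x) (secondFF u _ _ x), inner_meanCurv]
  simp only [real_inner_comm, Finset.mul_sum]
  refine Finset.sum_congr rfl fun i _ => Finset.sum_congr rfl fun j _ =>
    Finset.sum_congr rfl fun k _ => Finset.sum_congr rfl fun l _ => ?_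
  ring

namespace IsLagrangianChart

variable {u : Plane → C2} {U : Set Plane} {x : Plane} (hu : IsLagrangianChart u U) (hx : x ∈ U)

include hu hx

theorem det_metricInv_ne_zero : metricInv u x 0 0 * metricInv u x 1 1
    - metricInv u x 0 1 * metricInv u x 0 1 ≠ 0 := by
  have h := (Matrix.isUnit_nonsing_inv_det _ (Ne.isUnit (hu.det_ne_zero x hx))).ne_zero
  rw [Matrix.det_fin_two] at h
  have h2 := metricInv_symm u x 1 0
  rw [metricInv] at *
  rwa [h2] at h

/-- The cubic form lemmas take `g⁻¹` as primary data, so that `g` enters them only through one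
inverse determinant. -/
theorem metric_eq (i j : Fin 2) : metric u x i j
    = (metricInv u x 0 0 * metricInv u x 1 1 - metricInv u x 0 1 * metricInv u x 0 1)⁻¹
      * (!![metricInv u x 1 1, -metricInv u x 0 1; -metricInv u x 0 1, metricInv u x 0 0] :
          Matrix (Fin 2) (Fin 2) ℝ) i j := by
  have h : (metricInv u x)⁻¹ = metric u x :=
    Matrix.nonsing_inv_nonsing_inv _ (Ne.isUnit (hu.det_ne_zero x hx))
  conv_lhs => rw [← h, Matrix.inv_def, Matrix.det_fin_two, Matrix.adjugate_fin_two,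
    Ring.inverse_eq_inv', Matrix.smul_apply, smul_eq_mul, metricInv_symm u x 1 0]

theorem inner_normal_meanCurv (V : C2) : (inner ℝ V (meanCurv u x) : ℝ)
    = ∑ k, ∑ l, metricInv u x k l * inner ℝ (meanCurv u x) (J (pd l u x))
      * inner ℝ V (J (pd k u x)) := by
  conv_lhs => rw [hu.normal_expansion hx (hu.inner_meanCurv_tangent hx)]
  simp only [inner_sum, inner_smul_right, Finset.sum_mul]

theorem norm_meanCurv_sq_eq : ‖meanCurv u x‖ ^ 2
    = ∑ i, ∑ j, metricInv u x i j * inner ℝ (meanCurv u x) (J (pd i u x))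
      * inner ℝ (meanCurv u x) (J (pd j u x)) := by
  rw [← real_inner_self_eq_norm_sq, hu.inner_normal_meanCurv hx]
  refine Finset.sum_congr rfl fun i _ => Finset.sum_congr rfl fun j _ => by ring

theorem Qop_tracefreeA_eq :
    Qop u (tracefreeA u) (meanCurv u) x
      = ((1 / 8 : ℝ) * ‖meanCurv u x‖ ^ 2) • meanCurv u x
        + Qop u (checkA u) (meanCurv u) x
        + evalDiag u (checkA u) (fun y => J (meanCurv u y)) x := by
  refine hu.normal_ext hx (fun m => ?_) fun m => ?_
  · simp only [Qop, evalDiag, inner_add_left, sum_inner, inner_smul_left, inner_tracefreeA,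
      inner_checkA, hu.inner_secondFF_tangent hx, hu.inner_meanCurv_tangent hx,
      hu.inner_J x hx, mul_zero, add_zero, sub_zero, Finset.sum_const_zero]
  -- The components of `JH` enter with a minus sign there, since `⟨JH, ∂ₖu⟩ = -⟨H, J ∂ₖu⟩`.
  · have key := cubic_form_identity
      (c := fun i j k => inner ℝ (secondFF u i j x) (J (pd k u x)))
      (g := fun i j => metric u x i j) (h := fun i j => metricInv u x i j)
      (η := fun k => inner ℝ (meanCurv u x) (J (pd k u x)))
      (s := fun i j => inner ℝ (secondFF u i j x) (meanCurv u x)) (n := ‖meanCurv u x‖ ^ 2)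
      (fun i j k => by rw [hu.secondFF_symm hx]) (hu.inner_secondFF_J_symm hx)
      (metricInv_symm u x 1 0) (hu.det_metricInv_ne_zero hx) (hu.metric_eq hx)
      (fun k => inner_meanCurv u x _) (fun i j => hu.inner_normal_meanCurv hx _)
      (hu.norm_meanCurv_sq_eq hx) m
    simp only [Qop, evalDiag, tangComp, inner_add_left, sum_inner, inner_smul_left,
      RCLike.conj_to_real, inner_tracefreeA, inner_checkA, inner_J_J, ← metric_apply,
      real_inner_self_eq_norm_sq, inner_J_left (meanCurv u x),
      real_inner_comm (meanCurv u x) (J _)]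
    simp only [Fin.sum_univ_two] at key ⊢
    linear_combination key

theorem normSqTensor_checkA : normSqTensor u (checkA u) x
    = normSqTensor u (secondFF u) x - (3 / 4) * ‖meanCurv u x‖ ^ 2 := by
  have key := cubic_form_norm
    (c := fun i j k => inner ℝ (secondFF u i j x) (J (pd k u x)))
    (g := fun i j => metric u x i j) (h := fun i j => metricInv u x i j)
    (η := fun k => inner ℝ (meanCurv u x) (J (pd k u x)))
    (s := fun i j => inner ℝ (secondFF u i j x) (meanCurv u x)) (n := ‖meanCurv u x‖ ^ 2)
    (fun i j k => by rw [hu.secondFF_symm hx]) (hu.inner_secondFF_J_symm hx)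
    (metricInv_symm u x 1 0) (hu.det_metricInv_ne_zero hx) (hu.metric_eq hx)
    (fun k => inner_meanCurv u x _) (fun i j => hu.inner_normal_meanCurv hx _)
    (hu.norm_meanCurv_sq_eq hx)
  have h1 : ∀ W k l, (inner ℝ W (checkA u k l x) : ℝ) = inner ℝ (checkA u k l x) W :=
    fun W k l => real_inner_comm _ _
  -- The product `⟨A, A⟩` is split off; the bracket is the summand of `cubic_form_norm`, whose
  -- contraction is `-¾|H|²`.
  have h2 : ∀ i j k l, (inner ℝ (checkA u i j x) (checkA u k l x) : ℝ)
      = inner ℝ (secondFF u i j x) (secondFF u k l x)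
      + (-(1 / 4) * (metric u x k l * inner ℝ (secondFF u i j x) (meanCurv u x)
          + inner ℝ (meanCurv u x) (J (pd k u x)) * inner ℝ (secondFF u i j x) (J (pd l u x))
          + inner ℝ (meanCurv u x) (J (pd l u x)) * inner ℝ (secondFF u i j x) (J (pd k u x)))
        - (1 / 4) * (metric u x i j * inner ℝ (secondFF u k l x) (meanCurv u x)
          + inner ℝ (meanCurv u x) (J (pd i u x)) * inner ℝ (secondFF u k l x) (J (pd j u x))
          + inner ℝ (meanCurv u x) (J (pd j u x)) * inner ℝ (secondFF u k l x) (J (pd i u x)))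
        + (1 / 16) * (metric u x i j * metric u x k l * ‖meanCurv u x‖ ^ 2
          + 2 * metric u x i j * inner ℝ (meanCurv u x) (J (pd k u x))
            * inner ℝ (meanCurv u x) (J (pd l u x))
          + 2 * metric u x k l * inner ℝ (meanCurv u x) (J (pd i u x))
            * inner ℝ (meanCurv u x) (J (pd j u x))
          + inner ℝ (meanCurv u x) (J (pd i u x)) * inner ℝ (meanCurv u x) (J (pd k u x))
            * metric u x j l
          + inner ℝ (meanCurv u x) (J (pd i u x)) * inner ℝ (meanCurv u x) (J (pd l u x))
            * metric u x j k
          + inner ℝ (meanCurv u x) (J (pd j u x)) * inner ℝ (meanCurv u x) (J (pd k u x))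
            * metric u x i l
          + inner ℝ (meanCurv u x) (J (pd j u x)) * inner ℝ (meanCurv u x) (J (pd l u x))
            * metric u x i k)) := by
    intro i j k l
    have h3 := inner_checkA u x k l (secondFF u i j x)
    rw [real_inner_comm (secondFF u i j x) (secondFF u k l x),
      real_inner_comm (secondFF u i j x) (meanCurv u x),
      real_inner_comm (secondFF u i j x) (J (pd k u x)),
      real_inner_comm (secondFF u i j x) (J (pd l u x))] at h3
    have h4 := inner_checkA u x k l (meanCurv u x)
    have h5 : ∀ i, (inner ℝ (checkA u k l x) (J (pd i u x)) : ℝ) = _ :=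
      fun i => inner_checkA u x k l (J (pd i u x))
    rw [inner_checkA u x i j]
    simp only [h1, h3, h4, h5, inner_J_J, ← metric_apply,
      real_inner_self_eq_norm_sq, real_inner_comm (meanCurv u x) (J _)]
    rw [metric_symm u x k i, metric_symm u x l i, metric_symm u x k j, metric_symm u x l j]
    ring
  simp only [normSqTensor, h2]
  simp only [Fin.sum_univ_two] at key ⊢
  linear_combination key

/-! ### The curvature term and the dual form -/

/-- The trace of the commutator is the Ricci curvature applied to `JH`. In dimension two this is the
Gauss curvature times the form. -/
theorem contract_ricci (k : Fin 2) :
    ∑ i, ∑ j, metricInv u x i j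
        * (covDerivTensor u (covDerivForm u (contract u (meanCurv u))) i k j x
          - covDerivTensor u (covDerivForm u (contract u (meanCurv u))) k i j x)
      = (1 / 2) * (‖meanCurv u x‖ ^ 2 - normSqTensor u (secondFF u) x)
        * contract u (meanCurv u) k x := by
  have hw := hu.secondFF_symm hx 1 0
  simp only [hu.covDerivTensor_commutator hx, norm_meanCurv_sq, normSqTensor, tangComp,
    ← contract_eq_inner]
  fin_cases k <;>
  simp only [Fin.sum_univ_two, metricInv_symm u x 1 0, hw, Fin.zero_eta, Fin.mk_one,
    real_inner_comm (secondFF u 0 0 x) (secondFF u 0 1 x),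
    real_inner_comm (secondFF u 0 0 x) (secondFF u 1 1 x),
    real_inner_comm (secondFF u 0 1 x) (secondFF u 1 1 x)] <;>
  ring

theorem normalLaplacian_dual (k : Fin 2) :
    contract u (normalLaplacian u (meanCurv u)) k x
      = -2 * adjointDeriv u (tensorT u) k x
        + (1 / 2) * (normSqTensor u (secondFF u) x - ‖meanCurv u x‖ ^ 2)
          * contract u (meanCurv u) k x := by
  set B := covDerivForm u (contract u (meanCurv u)) with hB
  have hBs : ∀ i j, ContDiffOn ℝ ∞ (B i j) U :=
    hu.contDiffOn_covDerivForm hu.contDiffOn_contract_meanCurv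
  have htr : ContDiffOn ℝ ∞ (fun y => ∑ i, ∑ j, metricInv u y i j * B i j y) U :=
    ContDiffOn.sum fun i _ => ContDiffOn.sum fun j _ => (hu.contDiffOn_metricInv i j).mul (hBs i j)
  -- By `divergence_J_meanCurv`, `T = B - ½ (tr B) g`; the metric is parallel, so only `tr B` is
  -- differentiated.
  have hT : ∀ i j k, covDerivTensor u (tensorT u) i j k x
      = covDerivTensor u B i j k x - (1 / 2) * (∑ a, ∑ b, metricInv u x a b
        * covDerivTensor u B i a b x) * metric u x j k := by
    intro i j k
    have hcongr : covDerivTensor u (tensorT u) i j k x = covDerivTensor u (fun a b y => B a b y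
        - (1 / 2 * ∑ i, ∑ j, metricInv u y i j * B i j y) * metric u y a b) i j k x := by
      have h1 : ∀ y ∈ U, ∀ a b, tensorT u a b y = B a b y
          - (1 / 2 * ∑ i, ∑ j, metricInv u y i j * B i j y) * metric u y a b := by
        intro y hy a b
        rw [tensorT, hu.divergence_J_meanCurv hy]
      simp only [covDerivTensor, pd_congr hu.isOpen hx fun y hy => h1 y hy j k, h1 x hx]
    have hc := contDiffOn_const (c := (1 / 2 : ℝ)).mul htr
    have hp : pd i (fun y => 1 / 2 * ∑ i, ∑ j, metricInv u y i j * B i j y) x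
        = 1 / 2 * ∑ a, ∑ b, metricInv u x a b * covDerivTensor u B i a b x := by
      rw [pd_mul (differentiableAt_const _) (hu.differentiableAt hx htr), pd_const,
        hu.pd_trace hx hBs]
      ring
    rw [hcongr, hu.covDerivTensor_sub hx hBs fun a b => hc.mul (hu.contDiffOn_metric a b),
      hu.covDerivTensor_smul_metric hx hc, hp]
  have hsymm : ∀ i j k, covDerivTensor u B i j k x = covDerivTensor u B i k j x := by
    intro i j k
    have h1 : ∀ y ∈ U, ∀ a b, B a b y = B b a y := fun y hy a b =>
      hu.covDerivForm_meanCurv_symm hy a b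
    simp only [covDerivTensor, pd_congr hu.isOpen hx fun y hy => h1 y hy j k,
      h1 x hx _ k, h1 x hx j]
    ring
  have hric := hu.contract_ricci hx k
  rw [hu.contract_normalLaplacian_meanCurv hx, ← hB, adjointDeriv]
  rw [← hB] at hric
  have h0 := hu.metricInv_mul hx 0 k
  have h1 := hu.metricInv_mul hx 1 k
  -- By `pd_trace`, `D` is the differential of `tr B`.
  let D : Fin 2 → ℝ := fun i => ∑ a, ∑ b, metricInv u x a b * covDerivTensor u B i a b x
  have hD : ∀ i, ∑ a, ∑ b, metricInv u x a b * covDerivTensor u B i a b x = D i := fun _ => rfl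
  simp only [hT, hD, hsymm _ _ k]
  have hric' : ∑ i, ∑ j, metricInv u x i j * covDerivTensor u B i k j x - D k
      = (1 / 2) * (‖meanCurv u x‖ ^ 2 - normSqTensor u (secondFF u) x)
        * contract u (meanCurv u) k x := by
    rw [← hric, ← hD]
    simp only [mul_sub, Finset.sum_sub_distrib]
  have hDk : D 0 * (if 0 = k then 1 else 0) + D 1 * (if 1 = k then 1 else 0) = D k := by
    fin_cases k <;> simp
  simp only [Fin.sum_univ_two] at hric' h0 h1 ⊢
  linear_combination D 0 * h0 + D 1 * h1 + hDk - hric'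

theorem willmoreOp_eq : willmoreOp u x = normalLaplacian u (meanCurv u) x
    + ((1 / 8 : ℝ) * ‖meanCurv u x‖ ^ 2) • meanCurv u x
    + Qop u (checkA u) (meanCurv u) x
    + evalDiag u (checkA u) (fun y => J (meanCurv u y)) x := by
  rw [willmoreOp, hu.Qop_tracefreeA_eq hx]
  simp only [add_assoc]

/-- The `|H|²` coefficients sum to zero: `⅛` from the first identity, `-½` from the curvature and `½
· ¾` from `|A|²`. -/
theorem contract_willmoreOp (k : Fin 2) : contract u (willmoreOp u) k x
    = -2 * adjointDeriv u (tensorT u) k x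
      + (1 / 2) * normSqTensor u (checkA u) x * contract u (meanCurv u) k x
      + contract u (Qop u (checkA u) (meanCurv u)) k x
      + contract u (evalDiag u (checkA u) (fun y => J (meanCurv u y))) k x := by
  have h := hu.normalLaplacian_dual hx k
  rw [contract_eq_inner, hu.willmoreOp_eq hx, hu.normSqTensor_checkA hx]
  simp only [J_add, J_smul, inner_add_left, inner_smul_left, RCLike.conj_to_real,
    ← contract_eq_inner]
  rw [h]
  ring

end IsLagrangianChart

/-! ### Coordinate representations of Lagrangian immersions -/

theorem sum_smul_pd (u : Plane → C2) (x : Plane) (v : Plane) :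
    fderiv ℝ u x v = v 0 • pd 0 u x + v 1 • pd 1 u x := by
  have hv : v = v 0 • EuclideanSpace.single 0 (1 : ℝ) + v 1 • EuclideanSpace.single 1 (1 : ℝ) := by
    ext i
    fin_cases i <;> simp
  conv_lhs => rw [hv]
  simp only [map_add, map_smul, pd]

theorem det_metric_ne_zero {u : Plane → C2} {x : Plane}
    (h : Function.Injective (fderiv ℝ u x)) : (metric u x).det ≠ 0 := by
  have h0 : pd 0 u x ≠ 0 := by
    intro h0
    have := h (a₁ := EuclideanSpace.single 0 1) (a₂ := 0) (by rw [map_zero]; exact h0)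
    simpa using congrArg (fun v : Plane => v 0) this
  intro hdet
  rw [Matrix.det_fin_two] at hdet
  -- This `v` spans the kernel of a degenerate `g` when `g₀₀ ≠ 0`: `|du(v)|² = g₀₀ det g`.
  set v : Plane := !₂[-metric u x 0 1, metric u x 0 0] with hv
  have hfv : fderiv ℝ u x v = -metric u x 0 1 • pd 0 u x + metric u x 0 0 • pd 1 u x := by
    rw [sum_smul_pd]; simp [hv]
  have hz : fderiv ℝ u x v = 0 := by
    rw [← inner_self_eq_zero (𝕜 := ℝ), hfv]
    simp only [inner_add_left, inner_add_right, inner_smul_left, inner_smul_right,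
      RCLike.conj_to_real, ← metric_apply]
    rw [metric_symm u x 1 0] at *
    linear_combination metric u x 0 0 * hdet
  have hv0 : v = 0 := h (by rw [hz, map_zero])
  have h1 : metric u x 0 0 = 0 := by simpa [hv] using congrArg (fun v : Plane => v 1) hv0
  exact h0 (inner_self_eq_zero.1 h1)

theorem IsLagrangianImmersion.isLagrangianChart {M : Type*} [TopologicalSpace M]
    [ChartedSpace Plane M] [IsManifold 𝓘(ℝ, Plane) ∞ M] {f : M → C2}
    (hf : IsLagrangianImmersion f) {e : OpenPartialHomeomorph M Plane}
    (he : e ∈ IsManifold.maximalAtlas 𝓘(ℝ, Plane) ∞ M) :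
    IsLagrangianChart (f ∘ e.symm) e.target := by
  have hsymm := contMDiffOn_symm_of_mem_maximalAtlas he
  have hfe : ∀ y ∈ e.target, ∀ v, fderiv ℝ (f ∘ e.symm) y v
      = mfderiv 𝓘(ℝ, Plane) 𝓘(ℝ, C2) f (e.symm y)
        (mfderiv 𝓘(ℝ, Plane) 𝓘(ℝ, Plane) e.symm y v) := by
    intro y hy v
    have h1 : MDifferentiableAt 𝓘(ℝ, Plane) 𝓘(ℝ, Plane) e.symm y :=
      (hsymm.contMDiffAt (e.open_target.mem_nhds hy)).mdifferentiableAt (by simp)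
    have h2 : MDifferentiableAt 𝓘(ℝ, Plane) 𝓘(ℝ, C2) f (e.symm y) :=
      (hf.smooth _).mdifferentiableAt (by simp)
    rw [← mfderiv_eq_fderiv, mfderiv_comp y h2 h1]
    rfl
  refine ⟨e.open_target, ?_, fun y hy => ?_, fun y hy i j => ?_⟩
  · exact contMDiffOn_iff_contDiffOn.1 (hf.smooth.comp_contMDiffOn hsymm)
  · apply det_metric_ne_zero
    have hinj : Function.Injective (mfderiv 𝓘(ℝ, Plane) 𝓘(ℝ, Plane) e.symm y) := by
      have h1 : MDifferentiableAt 𝓘(ℝ, Plane) 𝓘(ℝ, Plane) e.symm y :=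
        (hsymm.contMDiffAt (e.open_target.mem_nhds hy)).mdifferentiableAt (by simp)
      have h2 : MDifferentiableAt 𝓘(ℝ, Plane) 𝓘(ℝ, Plane) e (e.symm y) :=
        ((contMDiffOn_of_mem_maximalAtlas he).contMDiffAt
          (e.open_source.mem_nhds (e.map_target hy))).mdifferentiableAt (by simp)
      have h3 := mfderiv_comp y h2 h1
      -- The differential of `e` is a left inverse of that of `e.symm`, by the chain rule.
      have h4 : (e ∘ e.symm) =ᶠ[𝓝 y] id := by
        filter_upwards [e.open_target.mem_nhds hy] with z hz using e.right_inv hz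
      rw [h4.mfderiv_eq, mfderiv_id] at h3
      intro v w hvw
      have h5 := congrArg (mfderiv 𝓘(ℝ, Plane) 𝓘(ℝ, Plane) e (e.symm y)) hvw
      have h6 : ∀ v, mfderiv 𝓘(ℝ, Plane) 𝓘(ℝ, Plane) e (e.symm y)
          (mfderiv 𝓘(ℝ, Plane) 𝓘(ℝ, Plane) e.symm y v) = v := fun v =>
        (DFunLike.congr_fun h3 v).symm
      rwa [h6, h6] at h5
    intro v w hvw
    rw [hfe y hy, hfe y hy] at hvw
    exact hinj (hf.injective_mfderiv _ hvw)
  · rw [← omega_eq_inner, pd, pd, hfe y hy, hfe y hy]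
    exact hf.lagrangian _ _ _

end LagrangianSurface

theorem mainTheorem4 {M : Type*} [TopologicalSpace M] [ChartedSpace LagrangianSurface.Plane M]
    [IsManifold 𝓘(ℝ, LagrangianSurface.Plane) ∞ M] (f : M → LagrangianSurface.C2)
    (hf : LagrangianSurface.IsLagrangianImmersion f)
    (e : OpenPartialHomeomorph M LagrangianSurface.Plane)
    (he : e ∈ IsManifold.maximalAtlas 𝓘(ℝ, LagrangianSurface.Plane) ∞ M)
    (u : LagrangianSurface.Plane → LagrangianSurface.C2) (hu : u = f ∘ e.symm)
    (x : LagrangianSurface.Plane) (hx : x ∈ e.target) :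
    LagrangianSurface.willmoreOp u x =
        LagrangianSurface.normalLaplacian u (LagrangianSurface.meanCurv u) x
        + ((1 / 8 : ℝ) * ‖LagrangianSurface.meanCurv u x‖ ^ 2) • LagrangianSurface.meanCurv u x
        + LagrangianSurface.Qop u (LagrangianSurface.checkA u) (LagrangianSurface.meanCurv u) x
        + LagrangianSurface.evalDiag u (LagrangianSurface.checkA u)
            (fun y => LagrangianSurface.J (LagrangianSurface.meanCurv u y)) x ∧
    ∀ k : Fin 2,
      LagrangianSurface.contract u (LagrangianSurface.willmoreOp u) k x =
        -2 * LagrangianSurface.adjointDeriv u (LagrangianSurface.tensorT u) k x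
        + (1 / 2) * LagrangianSurface.normSqTensor u (LagrangianSurface.checkA u) x
            * LagrangianSurface.contract u (LagrangianSurface.meanCurv u) k x
        + LagrangianSurface.contract u
            (LagrangianSurface.Qop u (LagrangianSurface.checkA u)
              (LagrangianSurface.meanCurv u)) k x
        + LagrangianSurface.contract u
            (LagrangianSurface.evalDiag u (LagrangianSurface.checkA u)
              (fun y => LagrangianSurface.J (LagrangianSurface.meanCurv u y))) k x := by
  subst hu
  have h := hf.isLagrangianChart he
  exact ⟨h.willmoreOp_eq hx, fun k => h.contract_willmoreOp hx k⟩
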